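/- Let $n \ge 1$ and let $f(x) = a_n x^n + \dots + a_1 x + a_0$ be a polynomial of degree $n$ with real coefficients and $a_0 > 0$. Call $f$ \emph{expansive} if every complex root $\alpha$ of $f$ satisfies $|\alpha| > 1$. For $1 \le k \le n$ and each of the two signs $\pm$, let $D_k^{\pm}(f)$ be the determinant of the $k \times k$ matrix whose entry in row $i$ and column $j$ is $$d_{ij} = a_{j-i} \pm a_{i+j+n-k-1} \qquad (1 \le i, j \le k),$$ where $a_m = 0$ for $m < 0$ and for $m > n$. Then the following are equivalent: \begin{enumerate} \item $f$ is expansive; \item $D_k^+(f) > 0$ and $D_k^-(f) > 0$ for all $k$ with $1 \le k \le n$; \item $f(1) > 0$, $f(-1) > 0$, and $D_k^+(f) > 0$ and $D_k^-(f) > 0$ for all $k$ with $1 \le k \le n-1$; \item $D_k^+(f) > 0$ and $D_k^-(f) > 0$ for all $k \ge 1$ among $n, n-2, n-4, \dots$; \item $f(1) > 0$, $f(-1) > 0$, and $D_k^+(f) > 0$ and $D_k^-(f) > 0$ for all $k \ge 1$ among $n-1, n-3, n-5, \dots$. \end{enumerate} -/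

import Mathlib

open Polynomial

/-- A complex polynomial is expansive if all of its complex roots lie outside the closed unit
disc. -/
def Expansive (f : ℂ[X]) : Prop :=
  ∀ z : ℂ, f.IsRoot z → 1 < ‖z‖

/-- The coefficient `a_m` of `f`, with the convention that it is zero for every index `m` outside
the range `0, …, deg f`. -/
def intCoeff (f : ℝ[X]) (m : ℤ) : ℝ :=
  if 0 ≤ m ∧ m ≤ (f.natDegree : ℤ) then f.coeff m.toNat else 0

/-- The `k × k` matrix with entries `a_{j-i} ± a_{i+j+n-k-1}` for `1 ≤ i, j ≤ k`, where `n` is the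
degree of `f` and the sign is `s`. As `Fin k` counts from zero, the row and column numbers are
`i + 1` and `j + 1`. -/
def dMatrix (f : ℝ[X]) (s : ℤˣ) (k : ℕ) : Matrix (Fin k) (Fin k) ℝ :=
  Matrix.of fun i j =>
    intCoeff f (((j : ℤ) + 1) - ((i : ℤ) + 1)) +
      ((s : ℤ) : ℝ) *
        intCoeff f (((i : ℤ) + 1) + ((j : ℤ) + 1) + (f.natDegree : ℤ) - (k : ℤ) - 1)

/-- The determinant `D_k^±(f)`; the sign is `s = 1` or `s = -1`. -/
noncomputable def dDet (f : ℝ[X]) (s : ℤˣ) (k : ℕ) : ℝ :=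
  (dMatrix f s k).det

/-!
The proof is Schur's reduction. Let `f` have degree at most `n`, write `f*(x) = x ^ n f(1 / x)`
(`f.reflect n` in Mathlib), and let `f₁ = a₀ f - aₙ f*`, which has degree at most `n - 1`. Once
`|aₙ| < a₀`, every condition in the theorem passes between `(f, n, k)` and `(f₁, n - 1, k - 1)`,
so that everything follows by induction on the *nominal* degree `n`.

* Determinants (`cohnDet_succ_pos_iff`). The matrix of `D_k^s(f)` is `T(f) + s T(f*) J`, where
  `T(g)` is the upper triangular Toeplitz matrix of the first `k` coefficients of `g` and `J`
  reverses the order of the columns. As `J ^ 2 = 1` and `s ^ 2 = 1`, multiplication on the right by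
  `a₀ - s aₙ J` gives `T(f₁) + s T(x f₁*) J`. The last row of this matrix is
  `(0, …, 0, a₀ ^ 2 - aₙ ^ 2)`, and deleting the last row and column leaves the matrix of
  `D_{k-1}^s(f₁)`. For `|aₙ| < a₀` the determinant of `a₀ - s aₙ J` is positive, so `D_k^s(f)` and
  `D_{k-1}^s(f₁)` have the same sign.
* Roots (`expansive_schurTransform_iff`). If `f` is expansive then `|f*| ≤ |f|` on the unit disc,
  as each linear factor shows; hence `f₁ = a₀ f - aₙ f*` has no zero there. Conversely `f` is a
  positive multiple of `a₀ f₁ + aₙ x f₁*`, to which the same argument applies.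
* Values (`eval_one_schurTransform_pos_iff`, `eval_neg_one_schurTransform_pos_iff`). The numbers
  `f₁(±1)` are positive multiples of `f(±1)`.

It remains to see that each condition forces `|aₙ| < a₀`. For expansive `f` this is a statement on
the product of the roots. In the other direction `D_1^± = a₀ ± aₙ` gives it directly, and the sum
`D_2^+ + D_2^- = 2 (a₀ ^ 2 - aₙ ^ 2)` gives it too. One of `k = 1` and `k = 2` occurs among the
indices of either parity, which is why half of the determinants suffice.
-/

noncomputable section

/-! ### Toeplitz-plus-Hankel determinants -/

/-- The matrix `T(u) + s T(v) J` of size `k`, where `T(w)` is the upper triangular Toeplitz matrix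
with first row `w 0, …, w (k - 1)` and `J` reverses the order of the columns. -/
def toeplitzHankel (u v : ℕ → ℝ) (s : ℤˣ) (k : ℕ) : Matrix (Fin k) (Fin k) ℝ :=
  Matrix.of fun i j =>
    (if (i : ℕ) ≤ j then u (j - i) else 0) +
      ((s : ℤ) : ℝ) * (if (i : ℕ) + j < k then v (k - 1 - (i + j)) else 0)

/-- The exchange matrix `J`, with ones on the antidiagonal. -/
def exchange (k : ℕ) : Matrix (Fin k) (Fin k) ℝ :=
  (1 : Matrix (Fin k) (Fin k) ℝ).submatrix id Fin.rev

theorem mul_exchange {k : ℕ} (A : Matrix (Fin k) (Fin k) ℝ) :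
    A * exchange k = A.submatrix id Fin.rev := by
  ext i j
  simp [exchange, Matrix.mul_apply, Matrix.one_apply]

theorem exchange_mul_exchange (k : ℕ) : exchange k * exchange k = 1 := by
  rw [mul_exchange]
  ext i j
  simp [exchange, Matrix.one_apply]

theorem smul_one_add_smul_exchange_mul (k : ℕ) (a b c d : ℝ) :
    (a • (1 : Matrix (Fin k) (Fin k) ℝ) + b • exchange k) * (c • 1 + d • exchange k) =
      (a * c + b * d) • 1 + (a * d + b * c) • exchange k := by
  simp only [add_mul, mul_add, Matrix.smul_mul, Matrix.mul_smul, exchange_mul_exchange, one_mul,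
    mul_one, smul_smul]
  module

/-- The matrix `a + b J` is invertible with inverse a multiple of `a - b J`, and it is a square
`(p + q J) ^ 2`; hence its determinant is a nonzero square. -/
theorem det_smul_one_add_smul_exchange_pos (k : ℕ) {a b : ℝ} (h : |b| < a) :
    0 < (a • (1 : Matrix (Fin k) (Fin k) ℝ) + b • exchange k).det := by
  obtain ⟨h1, h2⟩ := abs_lt.mp h
  have hx : √(a + b) ^ 2 = a + b := Real.sq_sqrt (by linarith)
  have hy : √(a - b) ^ 2 = a - b := Real.sq_sqrt (by linarith)
  -- `p + q = √(a + b)` and `p - q = √(a - b)` solve `p ^ 2 + q ^ 2 = a` and `2 p q = b`.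
  set x := √(a + b)
  set y := √(a - b)
  have hsq : a • (1 : Matrix (Fin k) (Fin k) ℝ) + b • exchange k =
      (((x + y) / 2) • 1 + ((x - y) / 2) • exchange k) *
        (((x + y) / 2) • 1 + ((x - y) / 2) • exchange k) := by
    rw [smul_one_add_smul_exchange_mul]
    congr 2 <;> nlinarith
  have hne : (a • (1 : Matrix (Fin k) (Fin k) ℝ) + b • exchange k).det ≠ 0 := by
    have hprod := smul_one_add_smul_exchange_mul k a b a (-b)
    rw [show a * -b + b * a = 0 by ring, zero_smul, add_zero] at hprod
    have hdet := congrArg Matrix.det hprod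
    rw [Matrix.det_mul, Matrix.det_smul, Matrix.det_one, mul_one] at hdet
    refine left_ne_zero_of_mul (b := (a • (1 : Matrix (Fin k) (Fin k) ℝ) + (-b) • exchange k).det) ?_
    rw [hdet]
    exact pow_ne_zero _ (by nlinarith)
  refine lt_of_le_of_ne ?_ hne.symm
  rw [hsq, Matrix.det_mul]
  exact mul_self_nonneg _

theorem intUnits_cast_mul_self (s : ℤˣ) : ((s : ℤ) : ℝ) * ((s : ℤ) : ℝ) = 1 := by
  rcases Int.units_eq_one_or s with rfl | rfl <;> simp

/-- The effect of the Schur transform on matrices, before the shift of the second sequence. -/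
theorem toeplitzHankel_mul (u v : ℕ → ℝ) (s : ℤˣ) (k : ℕ) (a b : ℝ) :
    toeplitzHankel u v s k * (a • 1 + (-(((s : ℤ) : ℝ) * b)) • exchange k) =
      toeplitzHankel (fun m => a * u m - b * v m) (fun m => a * v m - b * u m) s k := by
  have hs := intUnits_cast_mul_self s
  rw [mul_add, Matrix.mul_smul, Matrix.mul_smul, mul_one, mul_exchange]
  ext i j
  have hi := i.2
  have hj := j.2
  have e1 : ((i : ℕ) ≤ k - (j + 1)) ↔ (i : ℕ) + j < k := by omega
  have e2 : ((i : ℕ) + (k - (j + 1)) < k) ↔ (i : ℕ) ≤ j := by omega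
  have e3 : k - ((j : ℕ) + 1) - i = k - 1 - (i + j) := by omega
  simp only [toeplitzHankel, Matrix.add_apply, Matrix.smul_apply, Matrix.of_apply,
    Matrix.submatrix_apply, id, Fin.val_rev, smul_eq_mul, e1, e2, e3]
  by_cases h : (i : ℕ) ≤ j
  · have e4 : k - 1 - ((i : ℕ) + (k - (j + 1))) = j - i := by omega
    simp only [h, if_true, e4]
    split_ifs <;> linear_combination (-b * v (j - i)) * hs
  · simp only [h, if_false]
    split_ifs <;> ring

/-- If `v 0 = 0`, the last row is `(0, …, 0, u 0)`, and deleting the last row and column shifts `v`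
by one place. -/
theorem det_toeplitzHankel_succ (u v : ℕ → ℝ) (hv : v 0 = 0) (s : ℤˣ) (k : ℕ) :
    (toeplitzHankel u v s (k + 1)).det =
      u 0 * (toeplitzHankel u (fun m => v (m + 1)) s k).det := by
  rw [Matrix.det_succ_row _ (Fin.last k), Fin.sum_univ_castSucc, Finset.sum_eq_zero, zero_add]
  · have hsub : (toeplitzHankel u v s (k + 1)).submatrix (Fin.last k).succAbove
        (Fin.last k).succAbove = toeplitzHankel u (fun m => v (m + 1)) s k := by
      ext i j
      simp only [toeplitzHankel, Matrix.submatrix_apply, Matrix.of_apply, Fin.succAbove_last,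
        Fin.val_castSucc]
      congr 2
      rcases lt_trichotomy ((i : ℕ) + j) k with h | h | h
      · rw [if_pos (by omega), if_pos h]
        congr 1
        omega
      · rw [if_pos (by omega), if_neg (by omega), h]
        simpa using hv
      · rw [if_neg (by omega), if_neg (by omega)]
    have hlast : toeplitzHankel u v s (k + 1) (Fin.last k) (Fin.last k) = u 0 := by
      simp only [toeplitzHankel, Matrix.of_apply, Fin.val_last, le_refl, if_true, Nat.sub_self]
      split_ifs with h
      · obtain rfl : k = 0 := by omega
        simp [hv]
      · simp
    rw [hsub, hlast, Fin.val_last, Even.neg_one_pow ⟨k, rfl⟩, one_mul]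
  · intro j _
    have hj := j.2
    have h1 : ¬ k ≤ (j : ℕ) := by omega
    have : toeplitzHankel u v s (k + 1) (Fin.last k) j.castSucc = 0 := by
      simp only [toeplitzHankel, Matrix.of_apply, Fin.val_last, Fin.val_castSucc, h1, if_false,
        zero_add]
      split_ifs with h
      · have : (j : ℕ) = 0 := by omega
        simp [this, hv]
      · simp
    rw [this]
    simp

theorem det_toeplitzHankel_succ_pos_iff {u v : ℕ → ℝ} (h : |v 0| < u 0) (s : ℤˣ) (k : ℕ) :
    0 < (toeplitzHankel u v s (k + 1)).det ↔
      0 < (toeplitzHankel (fun m => u 0 * u m - v 0 * v m)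
        (fun m => u 0 * v (m + 1) - v 0 * u (m + 1)) s k).det := by
  have hs : |-(((s : ℤ) : ℝ) * v 0)| < u 0 := by
    rcases Int.units_eq_one_or s with rfl | rfl <;> simpa using h
  have hc := det_smul_one_add_smul_exchange_pos (k + 1) hs
  have hm := congrArg Matrix.det (toeplitzHankel_mul u v s (k + 1) (u 0) (v 0))
  rw [Matrix.det_mul, det_toeplitzHankel_succ _ (fun m => u 0 * v m - v 0 * u m)
    (by ring : u 0 * v 0 - v 0 * u 0 = 0)] at hm
  have hΔ : 0 < u 0 * u 0 - v 0 * v 0 := by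
    obtain ⟨h1, h2⟩ := abs_lt.mp h
    nlinarith
  rw [← mul_pos_iff_of_pos_right hc, hm, mul_pos_iff_of_pos_left hΔ]

/-! ### The Schur transform of a polynomial -/

/-- The determinant `D_k^s(f)` for `f` regarded as a polynomial of nominal degree `n`, so that the
leading coefficient `aₙ` may vanish. -/
def cohnDet (n : ℕ) (f : ℝ[X]) (s : ℤˣ) (k : ℕ) : ℝ :=
  (toeplitzHankel f.coeff (f.reflect n).coeff s k).det

theorem dDet_eq_cohnDet (f : ℝ[X]) (s : ℤˣ) {k : ℕ} (hk : k ≤ f.natDegree) :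
    dDet f s k = cohnDet f.natDegree f s k := by
  unfold dDet cohnDet
  congr 1
  ext i j
  have hi := i.2
  have hj := j.2
  simp only [dMatrix, toeplitzHankel, Matrix.of_apply, intCoeff]
  refine congrArg₂ (· + ((s : ℤ) : ℝ) * ·) ?_ ?_
  · by_cases h : (i : ℕ) ≤ j
    · rw [if_pos h, if_pos (by omega)]
      congr 1
      omega
    · rw [if_neg h, if_neg (by omega)]
  · by_cases h : (i : ℕ) + j < k
    · rw [if_pos h, if_pos (by omega), coeff_reflect, revAt_le (by omega)]
      congr 1
      omega
    · rw [if_neg h, if_neg (by omega)]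

/-- The Schur transform `a₀ f - aₙ f*` of `f` regarded as a polynomial of nominal degree `n`. -/
def schurTransform (n : ℕ) (f : ℝ[X]) : ℝ[X] :=
  C (f.coeff 0) * f - C (f.coeff n) * f.reflect n

theorem coeff_schurTransform (n : ℕ) (f : ℝ[X]) (m : ℕ) :
    (schurTransform n f).coeff m =
      f.coeff 0 * f.coeff m - f.coeff n * (f.reflect n).coeff m := by
  simp [schurTransform]

theorem natDegree_schurTransform_le {n : ℕ} {f : ℝ[X]} (hf : f.natDegree ≤ n + 1) :
    (schurTransform (n + 1) f).natDegree ≤ n := by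
  rw [natDegree_le_iff_coeff_eq_zero]
  intro m hm
  rw [coeff_schurTransform, coeff_reflect]
  rcases Nat.lt_or_ge (n + 1) m with h | h
  · rw [revAt_eq_self_of_lt h, coeff_eq_zero_of_natDegree_lt (by omega : f.natDegree < m)]
    ring
  · obtain rfl : m = n + 1 := by omega
    rw [revAt_le le_rfl, Nat.sub_self]
    ring

theorem coeff_reflect_schurTransform {n : ℕ} {f : ℝ[X]} (hf : f.natDegree ≤ n + 1) (m : ℕ) :
    ((schurTransform (n + 1) f).reflect n).coeff m =
      f.coeff 0 * (f.reflect (n + 1)).coeff (m + 1) - f.coeff (n + 1) * f.coeff (m + 1) := by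
  rw [coeff_reflect, coeff_schurTransform, coeff_reflect, coeff_reflect]
  rcases Nat.lt_or_ge n m with h | h
  · rw [revAt_eq_self_of_lt h, revAt_eq_self_of_lt (by omega : n + 1 < m + 1)]
    have hz : f.coeff (m + 1) = 0 := coeff_eq_zero_of_natDegree_lt (by omega)
    rw [hz]
    rcases Nat.lt_or_ge (n + 1) m with h' | h'
    · rw [revAt_eq_self_of_lt h', coeff_eq_zero_of_natDegree_lt (by omega : f.natDegree < m)]
    · obtain rfl : m = n + 1 := by omega
      rw [revAt_le le_rfl, Nat.sub_self, mul_comm, sub_self, mul_zero, mul_zero, sub_self]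
  · rw [revAt_le h, revAt_le (by omega : n - m ≤ n + 1), revAt_le (by omega : m + 1 ≤ n + 1)]
    rw [show n + 1 - (n - m) = m + 1 by omega, show n + 1 - (m + 1) = n - m by omega]

/-- The Schur transform lowers `n` and `k` by one and preserves the sign of `D_k^s`. -/
theorem cohnDet_succ_pos_iff {n : ℕ} {f : ℝ[X]} (hf : f.natDegree ≤ n + 1)
    (h : |f.coeff (n + 1)| < f.coeff 0) (s : ℤˣ) (k : ℕ) :
    0 < cohnDet (n + 1) f s (k + 1) ↔ 0 < cohnDet n (schurTransform (n + 1) f) s k := by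
  have h0 : (f.reflect (n + 1)).coeff 0 = f.coeff (n + 1) := by
    rw [coeff_reflect, revAt_le (Nat.zero_le _), Nat.sub_zero]
  unfold cohnDet
  rw [det_toeplitzHankel_succ_pos_iff (by rwa [h0]), h0, funext (coeff_schurTransform (n + 1) f),
    funext (coeff_reflect_schurTransform hf)]

theorem schurTransform_coeff_zero_pos {n : ℕ} {f : ℝ[X]} (h : |f.coeff n| < f.coeff 0) :
    0 < (schurTransform n f).coeff 0 := by
  rw [coeff_schurTransform, coeff_reflect, revAt_le (Nat.zero_le _), Nat.sub_zero]
  obtain ⟨h1, h2⟩ := abs_lt.mp h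
  nlinarith

theorem cohnDet_one (n : ℕ) (f : ℝ[X]) (s : ℤˣ) :
    cohnDet n f s 1 = f.coeff 0 + ((s : ℤ) : ℝ) * f.coeff n := by
  simp [cohnDet, toeplitzHankel, coeff_reflect, revAt_le (Nat.zero_le _)]

theorem abs_coeff_lt_of_cohnDet_one_pos {n : ℕ} {f : ℝ[X]}
    (h : ∀ s, 0 < cohnDet n f s 1) : |f.coeff n| < f.coeff 0 := by
  have h1 := h 1
  have h2 := h (-1)
  simp only [cohnDet_one, Units.val_one, Units.val_neg, Int.cast_one, Int.cast_neg] at h1 h2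
  rw [abs_lt]
  constructor <;> linarith

theorem abs_coeff_lt_of_cohnDet_two_pos {n : ℕ} {f : ℝ[X]} (h0 : 0 < f.coeff 0)
    (h : ∀ s, 0 < cohnDet n f s 2) : |f.coeff n| < f.coeff 0 := by
  have h1 := h 1
  have h2 := h (-1)
  simp only [cohnDet, toeplitzHankel, Matrix.det_fin_two, Matrix.of_apply] at h1 h2
  simp [coeff_reflect, revAt_le (Nat.zero_le _)] at h1 h2
  -- The sum of the two determinants is `2 (a₀ ^ 2 - aₙ ^ 2)`.
  refine abs_lt_of_sq_lt_sq ?_ h0.le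
  nlinarith

/-! ### Values at `1` and `-1` -/

theorem aeval_reflect {K : Type*} [Field K] [Algebra ℝ K] {n : ℕ} {f : ℝ[X]}
    (hf : f.natDegree ≤ n) {z : K} (hz : z ≠ 0) :
    aeval z (f.reflect n) = z ^ n * aeval z⁻¹ f := by
  let : Invertible z⁻¹ := invertibleOfNonzero (inv_ne_zero hz)
  have h := eval₂_reflect_mul_pow (algebraMap ℝ K) z⁻¹ n f hf
  rw [invOf_eq_inv, inv_inv] at h
  rw [aeval_def, aeval_def, ← h, mul_left_comm, ← mul_pow, mul_inv_cancel₀ hz, one_pow, mul_one]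

theorem eval_one_reflect {n : ℕ} {f : ℝ[X]} (hf : f.natDegree ≤ n) :
    (f.reflect n).eval 1 = f.eval 1 := by
  simpa [coe_aeval_eq_eval] using aeval_reflect hf (one_ne_zero (α := ℝ))

theorem eval_neg_one_reflect {n : ℕ} {f : ℝ[X]} (hf : f.natDegree ≤ n) :
    (f.reflect n).eval (-1) = (-1) ^ n * f.eval (-1) := by
  simpa [coe_aeval_eq_eval, inv_neg] using
    aeval_reflect hf (neg_ne_zero.mpr (one_ne_zero (α := ℝ)))

theorem eval_one_schurTransform_pos_iff {n : ℕ} {f : ℝ[X]} (hf : f.natDegree ≤ n)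
    (h : |f.coeff n| < f.coeff 0) : 0 < (schurTransform n f).eval 1 ↔ 0 < f.eval 1 := by
  have : (schurTransform n f).eval 1 = (f.coeff 0 - f.coeff n) * f.eval 1 := by
    simp only [schurTransform, eval_sub, eval_mul, eval_C, eval_one_reflect hf]
    ring
  rw [this, mul_pos_iff_of_pos_left (by linarith [le_abs_self (f.coeff n)])]

theorem eval_neg_one_schurTransform_pos_iff {n : ℕ} {f : ℝ[X]} (hf : f.natDegree ≤ n)
    (h : |f.coeff n| < f.coeff 0) : 0 < (schurTransform n f).eval (-1) ↔ 0 < f.eval (-1) := by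
  have : (schurTransform n f).eval (-1) = (f.coeff 0 - (-1) ^ n * f.coeff n) * f.eval (-1) := by
    simp only [schurTransform, eval_sub, eval_mul, eval_C, eval_neg_one_reflect hf]
    ring
  rw [this, mul_pos_iff_of_pos_left]
  obtain ⟨h1, h2⟩ := abs_lt.mp h
  rcases neg_one_pow_eq_or ℝ n with h' | h' <;> rw [h'] <;> linarith

/-! ### Roots -/

/-- The elementary estimate behind `|f*| ≤ |f|`, for one linear factor. -/
theorem norm_one_sub_mul_conj_le {z w : ℂ} (hz : ‖z‖ ≤ 1) (hw : 1 ≤ ‖w‖) :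
    ‖1 - w * (starRingEnd ℂ) z‖ ≤ ‖z - w‖ := by
  refine le_of_sq_le_sq ?_ (norm_nonneg _)
  have hz' : ‖z‖ ^ 2 ≤ 1 := by nlinarith [norm_nonneg z]
  have hw' : 1 ≤ ‖w‖ ^ 2 := by nlinarith
  rw [← Complex.normSq_eq_norm_sq, Complex.normSq_apply] at *
  rw [← Complex.normSq_eq_norm_sq, Complex.normSq_apply] at *
  simp at *
  nlinarith [mul_nonneg (sub_nonneg.mpr hz') (sub_nonneg.mpr hw')]

theorem norm_pow_mul_prod_inv_sub_le {z : ℂ} (hz0 : z ≠ 0) (hz : ‖z‖ ≤ 1) (S : Multiset ℂ)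
    (hS : ∀ w ∈ S, 1 < ‖w‖) :
    ‖z‖ ^ S.card * ‖(S.map fun w => ((starRingEnd ℂ) z)⁻¹ - w).prod‖ ≤
      ‖(S.map fun w => z - w).prod‖ := by
  induction S using Multiset.induction_on with
  | empty => simp
  | cons w S ih =>
    have ih' := ih fun x hx => hS x (Multiset.mem_cons_of_mem hx)
    have hw := norm_one_sub_mul_conj_le hz (hS w (Multiset.mem_cons_self w S)).le
    have hfac : ‖z‖ * ‖((starRingEnd ℂ) z)⁻¹ - w‖ = ‖1 - w * (starRingEnd ℂ) z‖ := by
      rw [← RCLike.norm_conj z, ← norm_mul]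
      congr 1
      have : (starRingEnd ℂ) z ≠ 0 := by simpa using hz0
      field_simp
    simp only [Multiset.map_cons, Multiset.prod_cons, Multiset.card_cons, norm_mul, pow_succ]
    calc _ = (‖z‖ * ‖((starRingEnd ℂ) z)⁻¹ - w‖) *
          (‖z‖ ^ S.card * ‖(S.map fun w => ((starRingEnd ℂ) z)⁻¹ - w).prod‖) := by ring
      _ ≤ _ := by
        rw [hfac]
        gcongr

theorem aeval_eq_leadingCoeff_mul_prod (f : ℝ[X]) (z : ℂ) :
    aeval z f = (f.leadingCoeff : ℂ) *
      ((f.map (algebraMap ℝ ℂ)).roots.map fun w => z - w).prod := by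
  have h := (IsAlgClosed.splits (f.map (algebraMap ℝ ℂ))).eval_eq_prod_roots z
  rw [eval_map_algebraMap] at h
  rw [h]
  simp

theorem Expansive.one_lt_norm {f : ℝ[X]} (h : Expansive (f.map (algebraMap ℝ ℂ))) :
    ∀ w ∈ (f.map (algebraMap ℝ ℂ)).roots, 1 < ‖w‖ :=
  fun w hw => h w (isRoot_of_mem_roots hw)

/-- If `f` is expansive then `|f*| ≤ |f|` on the punctured unit disc. As `f` is real,
`|f*(z)| = |z ^ n f(1 / z̄)|`, and the roots of `f` can be compared one by one. -/
theorem Expansive.norm_aeval_reflect_le {n : ℕ} {f : ℝ[X]} (hf : f.natDegree ≤ n)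
    (h : Expansive (f.map (algebraMap ℝ ℂ))) {z : ℂ} (hz0 : z ≠ 0) (hz : ‖z‖ ≤ 1) :
    ‖aeval z (f.reflect n)‖ ≤ ‖aeval z f‖ := by
  have hconj : ‖aeval z⁻¹ f‖ = ‖aeval ((starRingEnd ℂ) z)⁻¹ f‖ := by
    rw [← RCLike.norm_conj (aeval z⁻¹ f), ← aeval_conj, map_inv₀]
  have hcard : (f.map (algebraMap ℝ ℂ)).roots.card ≤ n :=
    (card_roots' _).trans ((natDegree_map _).le.trans hf)
  have hprod := norm_pow_mul_prod_inv_sub_le hz0 hz _ h.one_lt_norm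
  rw [aeval_reflect hf hz0, norm_mul, norm_pow, hconj, aeval_eq_leadingCoeff_mul_prod f,
    aeval_eq_leadingCoeff_mul_prod f, norm_mul, norm_mul]
  have hpow : ‖z‖ ^ n ≤ ‖z‖ ^ (f.map (algebraMap ℝ ℂ)).roots.card :=
    pow_le_pow_of_le_one (norm_nonneg z) hz hcard
  calc _ = ‖(f.leadingCoeff : ℂ)‖ * (‖z‖ ^ n *
        ‖((f.map (algebraMap ℝ ℂ)).roots.map fun w => ((starRingEnd ℂ) z)⁻¹ - w).prod‖) := by ring
    _ ≤ _ := by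
      refine mul_le_mul_of_nonneg_left (le_trans ?_ hprod) (norm_nonneg _)
      gcongr

theorem one_lt_norm_prod {S : Multiset ℂ} (hS : ∀ w ∈ S, 1 < ‖w‖) (h0 : S ≠ 0) :
    1 < ‖S.prod‖ := by
  induction S using Multiset.induction_on with
  | empty => exact absurd rfl h0
  | cons w S ih =>
    have hw := hS w (Multiset.mem_cons_self w S)
    rw [Multiset.prod_cons, norm_mul]
    by_cases h : S = 0
    · simpa [h] using hw
    · exact one_lt_mul_of_lt_of_le hw (ih (fun x hx => hS x (Multiset.mem_cons_of_mem hx)) h).le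

theorem Expansive.abs_coeff_lt {n : ℕ} {f : ℝ[X]} (hf : f.natDegree ≤ n + 1)
    (h : Expansive (f.map (algebraMap ℝ ℂ))) (h0 : 0 < f.coeff 0) :
    |f.coeff (n + 1)| < f.coeff 0 := by
  rcases hf.lt_or_eq with hlt | heq
  · rwa [coeff_eq_zero_of_natDegree_lt hlt, abs_zero]
  · have hlead : f.coeff (n + 1) = f.leadingCoeff := by rw [← heq]; rfl
    have hne : (f.map (algebraMap ℝ ℂ)).roots ≠ 0 := by
      rw [← Multiset.card_pos, ← (IsAlgClosed.splits (f.map (algebraMap ℝ ℂ))).natDegree_eq_card_roots,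
        natDegree_map, heq]
      omega
    have hz := congrArg norm (aeval_eq_leadingCoeff_mul_prod f 0)
    have hl : 0 < |f.leadingCoeff| := by
      rw [abs_pos, leadingCoeff_ne_zero]
      rintro rfl
      simp at h0
    have hp := one_lt_norm_prod h.one_lt_norm hne
    have hneg : ‖((f.map (algebraMap ℝ ℂ)).roots.map fun w => (0 : ℂ) - w).prod‖ =
        ‖(f.map (algebraMap ℝ ℂ)).roots.prod‖ := by
      simp [Multiset.prod_map_neg]
    rw [norm_mul, hneg, ← coeff_zero_eq_aeval_zero'] at hz
    simp only [Complex.coe_algebraMap, Complex.norm_real, Real.norm_eq_abs, abs_of_pos h0] at hz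
    rw [hlead, hz]
    exact lt_mul_of_one_lt_right hl hp

theorem expansive_map_iff {f : ℝ[X]} (h0 : f.coeff 0 ≠ 0) :
    Expansive (f.map (algebraMap ℝ ℂ)) ↔ ∀ z : ℂ, z ≠ 0 → ‖z‖ ≤ 1 → aeval z f ≠ 0 := by
  unfold Expansive
  simp only [IsRoot.def, eval_map_algebraMap]
  refine ⟨fun h z _ hz hr => absurd (h z hr) hz.not_gt, fun h z hr => ?_⟩
  by_contra! hz
  refine h z ?_ hz hr
  rintro rfl
  rw [← coeff_zero_eq_aeval_zero'] at hr
  exact h0 (by simpa using hr)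

/-- Given `|aₙ| < a₀`, a polynomial is expansive exactly when its Schur transform is. Both
directions say that `a₀ x = ± aₙ y` is impossible when `‖y‖ ≤ ‖x‖` and `x ≠ 0`. -/
theorem expansive_schurTransform_iff {n : ℕ} {f : ℝ[X]} (hf : f.natDegree ≤ n + 1)
    (h : |f.coeff (n + 1)| < f.coeff 0) :
    Expansive ((schurTransform (n + 1) f).map (algebraMap ℝ ℂ)) ↔
      Expansive (f.map (algebraMap ℝ ℂ)) := by
  have h0 : 0 < f.coeff 0 := (abs_nonneg _).trans_lt h
  have hΔ := schurTransform_coeff_zero_pos h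
  have hdom : ∀ x y : ℂ, x ≠ 0 → ‖y‖ ≤ ‖x‖ →
      (f.coeff 0 : ℂ) * x ≠ (f.coeff (n + 1) : ℂ) * y := by
    intro x y hx hyx heq
    have := congrArg norm heq
    simp only [norm_mul, Complex.norm_real, Real.norm_eq_abs, abs_of_pos h0] at this
    have hxp := norm_pos_iff.mpr hx
    nlinarith [abs_nonneg (f.coeff (n + 1))]
  constructor
  · intro hs
    rw [expansive_map_iff h0.ne']
    intro z hz0 hz hr
    have hle := hs.norm_aeval_reflect_le (natDegree_schurTransform_le hf) hz0 hz
    have hne := (expansive_map_iff hΔ.ne').mp hs z hz0 hz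
    -- Up to the factor `a₀ ^ 2 - aₙ ^ 2`, the polynomial `f` is recovered from its transform.
    have hinv : C (f.coeff 0) * schurTransform (n + 1) f +
        C (f.coeff (n + 1)) * (X * (schurTransform (n + 1) f).reflect n) =
        C (f.coeff 0 * f.coeff 0 - f.coeff (n + 1) * f.coeff (n + 1)) * f := by
      ext m
      rcases m with _ | m
      · simp only [coeff_add, mul_coeff_zero, coeff_C_zero, coeff_X_zero, coeff_schurTransform,
          coeff_reflect, revAt_le (Nat.zero_le _), Nat.sub_zero]
        ring
      · simp only [coeff_add, coeff_C_mul, coeff_X_mul, coeff_schurTransform,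
          coeff_reflect_schurTransform hf]
        ring
    have hev := congrArg (aeval z) hinv
    simp only [map_add, map_mul, aeval_C, aeval_X, hr, mul_zero, Complex.coe_algebraMap] at hev
    refine hdom _ (-(z * aeval z ((schurTransform (n + 1) f).reflect n))) hne ?_ ?_
    · rw [norm_neg, norm_mul]
      exact (mul_le_of_le_one_left (norm_nonneg _) hz).trans hle
    · linear_combination hev
  · intro he
    rw [expansive_map_iff hΔ.ne']
    intro z hz0 hz hr
    have hne := (expansive_map_iff h0.ne').mp he z hz0 hz
    refine hdom _ _ hne (he.norm_aeval_reflect_le hf hz0 hz) ?_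
    simp only [schurTransform, map_sub, map_mul, aeval_C, Complex.coe_algebraMap] at hr
    exact sub_eq_zero.mp hr

/-! ### Induction on the nominal degree -/

theorem expansive_of_natDegree_le_zero {f : ℝ[X]} (hf : f.natDegree ≤ 0) (h0 : 0 < f.coeff 0) :
    Expansive (f.map (algebraMap ℝ ℂ)) := by
  rw [expansive_map_iff h0.ne', eq_C_of_natDegree_le_zero hf]
  intro z _ _
  simpa using h0.ne'

theorem Expansive.cohnDet_pos {n : ℕ} {f : ℝ[X]} (hf : f.natDegree ≤ n)
    (h : Expansive (f.map (algebraMap ℝ ℂ))) (h0 : 0 < f.coeff 0) {k : ℕ} (hk : k ≤ n)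
    (s : ℤˣ) : 0 < cohnDet n f s k := by
  induction n generalizing f k with
  | zero =>
    obtain rfl : k = 0 := by omega
    simp [cohnDet]
  | succ n ih =>
    have hlt := h.abs_coeff_lt hf h0
    rcases k with _ | k
    · simp [cohnDet]
    · rw [cohnDet_succ_pos_iff hf hlt]
      exact ih (natDegree_schurTransform_le hf) ((expansive_schurTransform_iff hf hlt).mpr h)
        (schurTransform_coeff_zero_pos hlt) (by omega)

theorem Expansive.eval_pos {n : ℕ} {f : ℝ[X]} (hf : f.natDegree ≤ n)
    (h : Expansive (f.map (algebraMap ℝ ℂ))) (h0 : 0 < f.coeff 0) :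
    0 < f.eval 1 ∧ 0 < f.eval (-1) := by
  induction n generalizing f with
  | zero =>
    rw [eq_C_of_natDegree_le_zero hf]
    simpa using h0
  | succ n ih =>
    have hlt := h.abs_coeff_lt hf h0
    rw [← eval_one_schurTransform_pos_iff hf hlt, ← eval_neg_one_schurTransform_pos_iff hf hlt]
    exact ih (natDegree_schurTransform_le hf) ((expansive_schurTransform_iff hf hlt).mpr h)
      (schurTransform_coeff_zero_pos hlt)

/-- Positivity of `D_k^±` for the indices `1 ≤ k ≤ n` with `k ≡ n` modulo `2` suffices: the smallest
of them is `1` or `2`, and the Schur transform keeps the parity of `n - k`. -/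
theorem expansive_of_cohnDet_pos {n : ℕ} {f : ℝ[X]} (hf : f.natDegree ≤ n) (h0 : 0 < f.coeff 0)
    (h : ∀ k m : ℕ, 1 ≤ k → k + 2 * m = n → ∀ s, 0 < cohnDet n f s k) :
    Expansive (f.map (algebraMap ℝ ℂ)) := by
  induction n generalizing f with
  | zero => exact expansive_of_natDegree_le_zero hf h0
  | succ n ih =>
    have hlt : |f.coeff (n + 1)| < f.coeff 0 := by
      rcases Nat.even_or_odd' n with ⟨m, hm | hm⟩
      · exact abs_coeff_lt_of_cohnDet_one_pos (h 1 m le_rfl (by omega))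
      · exact abs_coeff_lt_of_cohnDet_two_pos h0 (h 2 m (by omega) (by omega))
    rw [← expansive_schurTransform_iff hf hlt]
    refine ih (natDegree_schurTransform_le hf) (schurTransform_coeff_zero_pos hlt) ?_
    intro k m _ hkm s
    exact (cohnDet_succ_pos_iff hf hlt s k).mp (h (k + 1) m (by omega) (by omega) s)

/-- Positivity of `f(±1)`, and of `D_k^±` for the indices `1 ≤ k < n` with `k ≢ n` modulo `2`,
suffices. -/
theorem expansive_of_eval_pos_of_cohnDet_pos {n : ℕ} {f : ℝ[X]} (hf : f.natDegree ≤ n)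
    (h0 : 0 < f.coeff 0) (h1 : 0 < f.eval 1) (h2 : 0 < f.eval (-1))
    (h : ∀ k m : ℕ, 1 ≤ k → k + 1 + 2 * m = n → ∀ s, 0 < cohnDet n f s k) :
    Expansive (f.map (algebraMap ℝ ℂ)) := by
  induction n generalizing f with
  | zero => exact expansive_of_natDegree_le_zero hf h0
  | succ n ih =>
    have hlt : |f.coeff (n + 1)| < f.coeff 0 := by
      rcases Nat.even_or_odd' n with ⟨_ | m, hm | hm⟩
      -- In nominal degree `1` there are no determinants, but `f(±1) = a₀ ± a₁`.
      · obtain rfl : n = 0 := by omega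
        rw [eval_eq_sum_range' (Nat.lt_succ_of_le hf)] at h1 h2
        simp [Finset.sum_range_succ] at h1 h2
        rw [abs_lt]
        constructor <;> simp only [zero_add] <;> linarith
      · exact abs_coeff_lt_of_cohnDet_one_pos (h 1 0 le_rfl (by omega))
      · exact abs_coeff_lt_of_cohnDet_two_pos h0 (h 2 m (by omega) (by omega))
      · exact abs_coeff_lt_of_cohnDet_one_pos (h 1 (m + 1) le_rfl (by omega))
    rw [← expansive_schurTransform_iff hf hlt]
    refine ih (natDegree_schurTransform_le hf) (schurTransform_coeff_zero_pos hlt)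
      ((eval_one_schurTransform_pos_iff hf hlt).mpr h1)
      ((eval_neg_one_schurTransform_pos_iff hf hlt).mpr h2) ?_
    intro k m _ hkm s
    exact (cohnDet_succ_pos_iff hf hlt s k).mp (h (k + 1) m (by omega) (by omega) s)

end

theorem mainTheorem1 (f : ℝ[X]) (n : ℕ) (hn : f.natDegree = n) (hn1 : 1 ≤ n)
    (ha0 : 0 < f.coeff 0) :
    -- the `D`-conditions for all `k`
    (Expansive (f.map (algebraMap ℝ ℂ)) ↔
      ∀ k : ℕ, 1 ≤ k → k ≤ n → ∀ s : ℤˣ, 0 < dDet f s k) ∧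
    -- those for `k = n` replaced by `f(±1) > 0`
    (Expansive (f.map (algebraMap ℝ ℂ)) ↔
      (0 < f.eval 1 ∧ 0 < f.eval (-1)) ∧
        ∀ k : ℕ, 1 ≤ k → k + 1 ≤ n → ∀ s : ℤˣ, 0 < dDet f s k) ∧
    -- only `k = n, n - 2, n - 4, …`
    (Expansive (f.map (algebraMap ℝ ℂ)) ↔
      ∀ k m : ℕ, 1 ≤ k → k + 2 * m = n → ∀ s : ℤˣ, 0 < dDet f s k) ∧
    -- `f(±1) > 0` and only `k = n - 1, n - 3, n - 5, …`
    (Expansive (f.map (algebraMap ℝ ℂ)) ↔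
      (0 < f.eval 1 ∧ 0 < f.eval (-1)) ∧
        ∀ k m : ℕ, 1 ≤ k → k + 1 + 2 * m = n → ∀ s : ℤˣ, 0 < dDet f s k) := by
  subst hn
  have hpos : Expansive (f.map (algebraMap ℝ ℂ)) → ∀ k ≤ f.natDegree, ∀ s, 0 < dDet f s k :=
    fun h k hk s => (dDet_eq_cohnDet f s hk).symm ▸ h.cohnDet_pos le_rfl ha0 hk s
  have heval : Expansive (f.map (algebraMap ℝ ℂ)) → 0 < f.eval 1 ∧ 0 < f.eval (-1) :=
    fun h => h.eval_pos le_rfl ha0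
  have hfour : (∀ k m : ℕ, 1 ≤ k → k + 2 * m = f.natDegree → ∀ s : ℤˣ, 0 < dDet f s k) →
      Expansive (f.map (algebraMap ℝ ℂ)) := fun h =>
    expansive_of_cohnDet_pos le_rfl ha0 fun k m hk hkm s =>
      dDet_eq_cohnDet f s (by omega : k ≤ f.natDegree) ▸ h k m hk hkm s
  have hfive : (0 < f.eval 1 ∧ 0 < f.eval (-1)) →
      (∀ k m : ℕ, 1 ≤ k → k + 1 + 2 * m = f.natDegree → ∀ s : ℤˣ, 0 < dDet f s k) →
      Expansive (f.map (algebraMap ℝ ℂ)) := fun he h =>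
    expansive_of_eval_pos_of_cohnDet_pos le_rfl ha0 he.1 he.2 fun k m hk hkm s =>
      dDet_eq_cohnDet f s (by omega : k ≤ f.natDegree) ▸ h k m hk hkm s
  refine ⟨⟨fun h k _ hk => hpos h k hk, fun h => hfour fun k m hk hkm => h k hk (by omega)⟩,
    ⟨fun h => ⟨heval h, fun k _ hk => hpos h k (by omega)⟩,
      fun h => hfive h.1 fun k m hk hkm => h.2 k hk (by omega)⟩,
    ⟨fun h k m _ hkm => hpos h k (by omega), hfour⟩,
    ⟨fun h => ⟨heval h, fun k m _ hkm => hpos h k (by omega)⟩, fun h => hfive h.1 h.2⟩⟩
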